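/- **Setting.** Let $d,q,k,m,s\in\mathbb N$. Let $\mathbb S^n$ be the space of real symmetric $n\times n$ matrices with the trace inner product, $\mathbb S^n_+\subseteq\mathbb S^n$ the cone of positive semidefinite matrices, and $$\widetilde X=\mathbb R^d\times\mathbb R^q\times\mathbb R^{q\times k}\times\prod_{p=1}^q\mathbb S^k\times\mathbb R^m,\qquad \widetilde Y=\prod_{i=1}^m\mathbb S^{k+1},$$ with the product Hilbert structures (Euclidean and Frobenius norms). For a set $S$ let $\iota_S$ be its indicator function ($0$ on $S$, $+\infty$ off $S$) and $P_S(v)$ the point of $S$ nearest to $v$. For $\varphi:V\to\,]-\infty,+\infty]$ on a finite-dimensional Hilbert space $V$ and $t>0$ let $\mathrm{Prox}_{t\varphi}(v)=\operatorname{argmin}_{u\in V}\{\varphi(u)+\frac1{2t}\|u-v\|^2\}$ and $\varphi^*(y)=\sup_{u\in V}\{\langle u,y\rangle-\varphi(u)\}$. Let $f:\mathbb R^d\to\,]-\infty,+\infty]$ be proper, convex and lower semicontinuous; let $\mathcal C\subseteq\mathbb R^d$ be nonempty, closed and convex; let $g_1,\dots,g_s\in\mathbb R[x_1,\dots,x_d]$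 be SOS-convex, that is, the Hessian of each $g_j$ equals $P_j^\top P_j$ for some polynomial matrix $P_j$; and suppose that $\mathcal D=\{x\in\mathbb R^d: g_j(x)\le0,\ j=1,\dots,s\}$ is nonempty. Let $b_i^{(0)}\in\mathbb R$, $\mathbf b_i\in\mathbb R^k$ and $B_i=\begin{bmatrix}0&-\frac12\mathbf b_i\\-\frac12\mathbf b_i^\top&-b_i^{(0)}\end{bmatrix}\in\mathbb S^{k+1}$, $i=1,\dots,m$. For $\widetilde x=(x,y_0,U,\Theta,\lambda)\in\widetilde X$ and $\widetilde y=(\Psi_1,\dots,\Psi_m)\in\widetilde Y$ put $$F(\widetilde x)=f(x)+\sum_{i=1}^m\iota_{\mathbb R_+}(\lambda_i),\quad E(\widetilde x)=\iota_{\mathcal C}(x),\quad H(\widetilde x)=\iota_{\mathcal D}(x),\quad G(\widetilde y)=\sum_{i=1}^m\iota_{B_i+\mathbb S_+^{k+1}}(\Psi_i).$$ Let $\omega$ be the smallest even integer with $\omega\ge2$ and $\omega\ge\deg g_j$ for all $j$, and let $\mathbf N^d_n=\{\alpha\in\mathbb N_0^d:\sum_i\alpha_i\le n\}$. For $\alpha\in\mathbf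 N^d_\omega$ let $M_\alpha$ be the symmetric matrix indexed by $\mathbf N^d_{\omega/2}$ whose $(\beta,\gamma)$ entry is $1$ if $\beta+\gamma=\alpha$ and $0$ otherwise. For $v\in\mathbb R^d$ write $\|v-x\|_2^2=\sum_\alpha h_\alpha x^\alpha$ and $g_j(x)=\sum_\alpha (g_j)_\alpha x^\alpha$, and consider the semidefinite program $$(\mathrm{MP}_v)\qquad \min_{y\in\mathbb R^{\mathbf N^d_\omega}}\Big\{\sum_{\alpha}h_\alpha y_\alpha:\ \sum_{\alpha}(g_j)_\alpha y_\alpha\le0\ (j=1,\dots,s),\ \sum_{\alpha}y_\alpha M_\alpha\succeq0,\ y_0=1\Big\}.$$ **Proposition (Closed-form formulas for proximal operators: two-stage ARO).** Let $\tau,\sigma>0$, $\widetilde x=(x,y_0,U,\Theta,\lambda)\in\widetilde X$ and $\widetilde y=(\Psi_1,\dots,\Psi_m)\in\widetilde Y$. All proximal points and projections below exist and are unique, and: 1. $\mathrm{Prox}_{\tau F}(\widetilde x)=\big(\mathrm{Prox}_{\tau f}(x),\,y_0,\,U,\,\Theta,\,P_{\mathbb R^m_+}(\lambda)\big)$, where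 $P_{\mathbb R^m_+}(\lambda)=(\max\{\lambda_1,0\},\dots,\max\{\lambda_m,0\})$. 2. $\mathrm{Prox}_{\sigma E^*}(\widetilde x)=\big(x-\sigma P_{\mathcal C}(x/\sigma),\,0,\,0,\,0,\,0\big)$. 3. $\mathrm{Prox}_{\sigma G^*}(\widetilde y)=\big(\Psi_i-\sigma B_i-\sigma P_{\mathbb S_+^{k+1}}(\Psi_i/\sigma-B_i)\big)_{i=1}^m$. 4. $\mathrm{Prox}_{\sigma H^*}(\widetilde x)=\big(x-\sigma P_{\mathcal D}(x/\sigma),\,0,\,0,\,0,\,0\big)$. Moreover, for every $v\in\mathbb R^d$ the program $(\mathrm{MP}_v)$ has a solution, and every solution $y^*$ satisfies $P_{\mathcal D}(v)=(y^*_{e_1},\dots,y^*_{e_d})$, where $e_i$ is the multi-index whose $i$-th component is one and whose other components are zero. -/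

import Mathlib

noncomputable section

namespace TwoStageARO

/-! ### Convex analysis in a real inner product space -/

section ConvexAnalysis

variable {V : Type*} [NormedAddCommGroup V] [InnerProductSpace ℝ V]

/-- An extended-real-valued function is proper if it never takes the value `-∞` and is
finite somewhere. -/
def IsProper (f : V → EReal) : Prop :=
  (∀ u, f u ≠ ⊥) ∧ ∃ u, f u ≠ ⊤

/-- Convexity of an extended-real-valued function: its epigraph is convex. -/
def IsConvexFun (f : V → EReal) : Prop :=
  Convex ℝ {p : V × ℝ | f p.1 ≤ (p.2 : EReal)}

open Classical in
/-- The indicator function of a set: `0` on the set and `+∞` elsewhere. -/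
def indicator {W : Type*} (C : Set W) (v : W) : EReal :=
  if v ∈ C then 0 else ⊤

/-- The Fenchel conjugate `f*(y) = sup_u (⟨u, y⟩ - f(u))`. -/
def conjugate (f : V → EReal) (y : V) : EReal :=
  ⨆ u : V, ((inner ℝ u y : ℝ) : EReal) - f u

/-- `Prox_{τ f}(v)`, as the set of all minimisers of `u ↦ f(u) + ‖u - v‖² / (2 τ)`. -/
def prox (τ : ℝ) (f : V → EReal) (v : V) : Set V :=
  {u | ∀ w : V, f u + ((1 / (2 * τ) * ‖u - v‖ ^ 2 : ℝ) : EReal)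
      ≤ f w + ((1 / (2 * τ) * ‖w - v‖ ^ 2 : ℝ) : EReal)}

/-- `P_C(v)`, as the set of all points of `C` that are nearest to `v`. -/
def proj (C : Set V) (v : V) : Set V :=
  {u | u ∈ C ∧ ∀ w ∈ C, ‖u - v‖ ≤ ‖w - v‖}

end ConvexAnalysis

/-! ### Spaces of matrices and the product spaces -/

/-- Real matrices with the Frobenius norm and the trace inner product. -/
abbrev Mat (a b : Type*) [Fintype a] [Fintype b] : Type _ := EuclideanSpace ℝ (a × b)

/-- Real symmetric matrices with the Frobenius norm and the trace inner product. -/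
def SymMat (n : Type*) [Fintype n] : Submodule ℝ (Mat n n) where
  carrier := {A | ∀ i j, A (i, j) = A (j, i)}
  add_mem' := by
    intro A B hA hB i j
    simp [hA i j, hB i j]
  zero_mem' := by
    intro i j
    simp
  smul_mem' := by
    intro c A hA i j
    simp [hA i j]

/-- A symmetric matrix as an element of Mathlib's matrix type. -/
def SymMat.toMatrix {n : Type*} [Fintype n] (A : SymMat n) : Matrix n n ℝ :=
  Matrix.of fun i j => (A : Mat n n) (i, j)

/-- The element of `SymMat n` with the entries of a given symmetric matrix. -/
def SymMat.ofMatrix {n : Type*} [Fintype n] (M : Matrix n n ℝ) (hM : M.IsSymm) : SymMat n :=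
  ⟨WithLp.toLp 2 fun p => M p.1 p.2, fun i j => (hM.apply i j).symm⟩

theorem SymMat.inner_eq_trace {n : Type*} [Fintype n] (A B : SymMat n) :
    inner ℝ A B = (SymMat.toMatrix A * SymMat.toMatrix B).trace := by
  have hB : ∀ i j, (B : Mat n n) (i, j) = (B : Mat n n) (j, i) := B.2
  simp only [Submodule.coe_inner, PiLp.inner_apply, Fintype.sum_prod_type, Matrix.trace,
    Matrix.diag, Matrix.mul_apply, SymMat.toMatrix, Matrix.of_apply]
  refine Finset.sum_congr rfl fun i _ => Finset.sum_congr rfl fun j _ => ?_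
  rw [← hB i j]
  simp [mul_comm]

/-- The cone of positive semidefinite symmetric matrices. -/
def psdCone (n : Type*) [Fintype n] : Set (SymMat n) :=
  {A | (SymMat.toMatrix A).PosSemidef}

/-- The nonnegative orthant. -/
def orthant (m : ℕ) : Set (EuclideanSpace ℝ (Fin m)) :=
  {l | ∀ i, 0 ≤ l i}

/-- The space `ℝ^d × ℝ^q × ℝ^{q×k} × ∏_{p=1}^q 𝕊^k × ℝ^m` with the product Hilbert structure. -/
abbrev XSpace (d q k m : ℕ) : Type :=
  WithLp 2 (EuclideanSpace ℝ (Fin d) × WithLp 2 (EuclideanSpace ℝ (Fin q) ×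
    WithLp 2 (Mat (Fin q) (Fin k) × WithLp 2 (PiLp 2 (fun _ : Fin q => SymMat (Fin k)) ×
      EuclideanSpace ℝ (Fin m)))))

/-- The tuple `(x, y₀, U, Θ, l)`. -/
def XSpace.mk {d q k m : ℕ} (x : EuclideanSpace ℝ (Fin d)) (y₀ : EuclideanSpace ℝ (Fin q))
    (U : Mat (Fin q) (Fin k)) (Θ : PiLp 2 (fun _ : Fin q => SymMat (Fin k)))
    (l : EuclideanSpace ℝ (Fin m)) : XSpace d q k m :=
  WithLp.toLp 2 (x, WithLp.toLp 2 (y₀, WithLp.toLp 2 (U, WithLp.toLp 2 (Θ, l))))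

/-- The component `x` of `(x, y₀, U, Θ, l)`. -/
def XSpace.x {d q k m : ℕ} (z : XSpace d q k m) : EuclideanSpace ℝ (Fin d) := z.fst

/-- The component `l` of `(x, y₀, U, Θ, l)`. -/
def XSpace.l {d q k m : ℕ} (z : XSpace d q k m) : EuclideanSpace ℝ (Fin m) :=
  z.snd.snd.snd.snd

/-- The space `∏_{i=1}^m 𝕊^{k+1}` with the product Hilbert structure; the rows and columns of
a `(k+1) × (k+1)` matrix are indexed by `Fin k ⊕ Unit`. -/
abbrev YSpace (k m : ℕ) : Type :=
  PiLp 2 (fun _ : Fin m => SymMat (Fin k ⊕ Unit))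

/-! ### The functionals of the composite problem -/

/-- `F(x, y₀, U, Θ, l) = f(x) + ∑ i, ι_{ℝ₊}(l_i)`. -/
def F {d : ℕ} (q k m : ℕ) (f : EuclideanSpace ℝ (Fin d) → EReal) (z : XSpace d q k m) : EReal :=
  f z.x + ∑ i, indicator (Set.Ici (0 : ℝ)) (z.l i)

/-- `E(x, y₀, U, Θ, l) = ι_C(x)`. -/
def E {d : ℕ} (q k m : ℕ) (C : Set (EuclideanSpace ℝ (Fin d))) (z : XSpace d q k m) : EReal :=
  indicator C z.x

/-- The block matrix `[[0, -b/2], [-bᵀ/2, -b₀]]`. -/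
def bMatrix {k : ℕ} (b₀ : ℝ) (b : Fin k → ℝ) : SymMat (Fin k ⊕ Unit) :=
  SymMat.ofMatrix
    (Matrix.fromBlocks 0 (Matrix.of fun l _ => -(1 / 2) * b l)
      (Matrix.of fun _ l => -(1 / 2) * b l) (Matrix.of fun _ _ => -b₀))
    (by ext i j; rcases i with i | i <;> rcases j with j | j <;> simp)

/-- `G(Ψ₁, …, Ψ_m) = ∑ i, ι_{B_i + 𝕊₊^{k+1}}(Ψ_i)`. -/
def G {k m : ℕ} (B : Fin m → SymMat (Fin k ⊕ Unit)) (Ψ : YSpace k m) : EReal :=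
  ∑ i, indicator ((fun S => B i + S) '' psdCone (Fin k ⊕ Unit)) (Ψ i)

/-- The set `{x | g_j(x) ≤ 0, j = 1, …, s}`. -/
def feasibleSet {d s : ℕ} (g : Fin s → MvPolynomial (Fin d) ℝ) :
    Set (EuclideanSpace ℝ (Fin d)) :=
  {x | ∀ j, MvPolynomial.eval (fun i => x i) (g j) ≤ 0}

/-- `H(x, y₀, U, Θ, l) = ι_D(x)` with `D = {x | g_j(x) ≤ 0, j = 1, …, s}`. -/
def H {d s : ℕ} (q k m : ℕ) (g : Fin s → MvPolynomial (Fin d) ℝ) (z : XSpace d q k m) : EReal :=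
  indicator (feasibleSet g) z.x

/-! ### SOS-convex polynomials and the moment semidefinite program -/

/-- The Hessian of a polynomial, as a matrix of polynomials. -/
def hessian {d : ℕ} (p : MvPolynomial (Fin d) ℝ) :
    Matrix (Fin d) (Fin d) (MvPolynomial (Fin d) ℝ) :=
  Matrix.of fun i j => MvPolynomial.pderiv i (MvPolynomial.pderiv j p)

/-- A polynomial is SOS-convex if its Hessian is `Pᵀ P` for some polynomial matrix `P`. -/
def IsSOSConvex {d : ℕ} (p : MvPolynomial (Fin d) ℝ) : Prop :=
  ∃ (ν : ℕ) (P : Matrix (Fin ν) (Fin d) (MvPolynomial (Fin d) ℝ)),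
    hessian p = P.transpose * P

/-- The smallest even integer that bounds the degrees of all `g_j` and of the quadratic
polynomial `‖v - x‖²`. -/
def truncOrder {d s : ℕ} (g : Fin s → MvPolynomial (Fin d) ℝ) : ℕ :=
  sInf {n | Even n ∧ 2 ≤ n ∧ ∀ j, (g j).totalDegree ≤ n}

theorem truncOrder_spec {d s : ℕ} (g : Fin s → MvPolynomial (Fin d) ℝ) :
    Even (truncOrder g) ∧ 2 ≤ truncOrder g ∧ ∀ j, (g j).totalDegree ≤ truncOrder g := by
  refine Nat.sInf_mem (s := {n | Even n ∧ 2 ≤ n ∧ ∀ j, (g j).totalDegree ≤ n})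
    ⟨2 * (1 + ∑ j, (g j).totalDegree), even_two_mul _, by omega, fun j => ?_⟩
  have := Finset.single_le_sum (f := fun j => (g j).totalDegree) (fun _ _ => Nat.zero_le _)
    (Finset.mem_univ j)
  omega

/-- The multi-indices in `d` variables of total degree at most `n`. -/
abbrev MultiIndex (d n : ℕ) : Type := {α : Fin d →₀ ℕ // α.degree ≤ n}

instance (d n : ℕ) : Fintype (MultiIndex d n) :=
  (Finsupp.finite_of_degree_le (σ := Fin d) n).fintype

/-- The zero multi-index. -/
def MultiIndex.zero (d n : ℕ) : MultiIndex d n := ⟨0, by simp⟩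

/-- The multi-index whose `i`-th component is one and whose other components vanish. -/
def MultiIndex.unit {d n : ℕ} (hn : 2 ≤ n) (i : Fin d) : MultiIndex d n :=
  ⟨Finsupp.single i 1, by rw [Finsupp.degree_single]; omega⟩

/-- The matrix `B_α`, indexed by the multi-indices of degree at most `n / 2`, whose `(β, γ)`
entry is the coefficient of `x^α` in `x^β x^γ`. -/
def momentBasis {d n : ℕ} (α : MultiIndex d n) :
    Matrix (MultiIndex d (n / 2)) (MultiIndex d (n / 2)) ℝ :=
  Matrix.of fun β γ => if β.1 + γ.1 = α.1 then 1 else 0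

/-- The Riesz functional `∑_α p_α y_α`. -/
def riesz {d n : ℕ} (y : MultiIndex d n → ℝ) (p : MvPolynomial (Fin d) ℝ) : ℝ :=
  ∑ α : MultiIndex d n, p.coeff α.1 * y α

/-- The polynomial `‖v - x‖²` in the variable `x`. -/
def sqDistPoly {d : ℕ} (v : EuclideanSpace ℝ (Fin d)) : MvPolynomial (Fin d) ℝ :=
  ∑ i, (MvPolynomial.C (v i) - MvPolynomial.X i) ^ 2

/-- Feasibility for the moment semidefinite program with truncation order `n`. -/
def IsMomentFeasible {d s n : ℕ} (g : Fin s → MvPolynomial (Fin d) ℝ)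
    (y : MultiIndex d n → ℝ) : Prop :=
  (∀ j, riesz y (g j) ≤ 0) ∧ (∑ α, y α • momentBasis α).PosSemidef ∧
    y (MultiIndex.zero d n) = 1

/-- `y` solves the moment semidefinite program that minimises `∑_α h_α y_α`, with
`h(x) = ‖v - x‖²`, over all feasible `y`. -/
def IsMomentSolution {d s n : ℕ} (g : Fin s → MvPolynomial (Fin d) ℝ)
    (v : EuclideanSpace ℝ (Fin d)) (y : MultiIndex d n → ℝ) : Prop :=
  IsMomentFeasible g y ∧
    ∀ y' : MultiIndex d n → ℝ, IsMomentFeasible g y' →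
      riesz y (sqDistPoly v) ≤ riesz y' (sqDistPoly v)

/-- The vector `(y_{e_1}, …, y_{e_d})` of first moments. -/
def firstMoments {d n : ℕ} (hn : 2 ≤ n) (y : MultiIndex d n → ℝ) :
    EuclideanSpace ℝ (Fin d) :=
  WithLp.toLp 2 fun i => y (MultiIndex.unit hn i)

end TwoStageARO

end

/-! Proximal points and projections are sets of minimisers, so an equation with a singleton asserts
existence, uniqueness and the formula at once.

The prox of `F` separates over the five blocks because the squared norm does. The conjugate formulas
are Moreau's decomposition: if `p` is the nearest point of `K` to `v / σ`, then `u = v - σ p` is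
normal to `K` at `p`. So `⟨p, ·⟩`, which always minorises the support function of `K`, touches it at
`u`, and completing the square makes `u` the unique minimiser (`prox_conjugate_indicator`).

The moment program is exact by Jensen's inequality for pseudo-moments
(`eval_firstMoments_le_riesz`). Let `L` be the Riesz functional and `u` the first moments of a
feasible `y`. For an SOS-convex `p`, the function `t ↦ L(p(u + t(x - u)))` equals `p(u)` at `0` and
`L(p)` at `1`, is stationary at `0`, and has as second derivative `L` of a sum of squares, which is
nonnegative; hence `p(u) ≤ L(p)`. So `u` lies in `D`. Nonnegative variance gives `‖u - v‖² ≤ L(‖x -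
v‖²)`, with equality for the Dirac moments at the projection of `v`. -/

namespace TwoStageARO

/-! ### Nearest points and Moreau decomposition. -/

section ConvexAnalysis

variable {V : Type*} [NormedAddCommGroup V] [InnerProductSpace ℝ V]

/-- A point of `K` that satisfies the variational inequality is the unique nearest point. -/
theorem proj_eq_singleton_of_inner_nonpos {K : Set V} {v p : V} (hp : p ∈ K)
    (h : ∀ w ∈ K, inner ℝ (v - p) (w - p) ≤ 0) : proj K v = {p} := by
  -- The angle at `p` is obtuse; the extra term `‖w - p‖²` yields uniqueness as well as minimality.
  have key : ∀ w ∈ K, ‖p - v‖ ^ 2 + ‖w - p‖ ^ 2 ≤ ‖w - v‖ ^ 2 := by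
    intro w hw
    have e : w - v = (w - p) - (v - p) := by abel
    rw [e, norm_sub_sq_real (w - p), norm_sub_rev p v, real_inner_comm]
    linarith [h w hw]
  ext u
  simp only [proj, Set.mem_ofPred_eq, Set.mem_singleton_iff]
  constructor
  · rintro ⟨hu, hmin⟩
    have h1 := key u hu
    have h2 : ‖u - v‖ ^ 2 ≤ ‖p - v‖ ^ 2 := by gcongr; exact hmin p hp
    have h3 : ‖u - p‖ ^ 2 = 0 := le_antisymm (by linarith) (sq_nonneg _)
    exact sub_eq_zero.1 (norm_eq_zero.1 (pow_eq_zero_iff two_ne_zero |>.1 h3))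
  · rintro rfl
    refine ⟨hp, fun w hw => ?_⟩
    refine le_of_sq_le_sq ?_ (norm_nonneg _)
    linarith [key w hw, sq_nonneg ‖w - u‖]

/-- Projection onto a nonempty closed convex set. -/
theorem exists_proj_eq_singleton [CompleteSpace V] {K : Set V} (hne : K.Nonempty)
    (hcl : IsClosed K) (hcv : Convex ℝ K) (v : V) :
    ∃ p, proj K v = {p} ∧ p ∈ K ∧ ∀ w ∈ K, inner ℝ (v - p) (w - p) ≤ 0 := by
  obtain ⟨p, hp, hmin⟩ := exists_norm_eq_iInf_of_complete_convex hne hcl.isComplete hcv v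
  have h := (norm_eq_iInf_iff_real_inner_le_zero hcv hp).1 hmin
  exact ⟨p, proj_eq_singleton_of_inner_nonpos hp h, hp, h⟩

/-- The Moreau decomposition for the indicator function of a set `K`. -/
theorem prox_conjugate_indicator {K : Set V} {v p : V} {σ : ℝ} (hσ : 0 < σ) (hp : p ∈ K)
    (h : ∀ w ∈ K, inner ℝ (σ⁻¹ • v - p) (w - p) ≤ 0) :
    prox σ (conjugate (indicator K)) v = {v - σ • p} := by
  set u := v - σ • p with hu
  -- The conjugate is the support function of `K`; it is attained at `p` because `u` is a positive
  -- multiple of the normal vector `σ⁻¹ • v - p`.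
  have hconj : conjugate (indicator K) u = ((inner ℝ p u : ℝ) : EReal) := by
    apply le_antisymm
    · refine iSup_le fun w => ?_
      by_cases hw : w ∈ K
      · simp only [indicator, if_pos hw, sub_zero]
        have e : u = σ • (σ⁻¹ • v - p) := by
          rw [smul_sub, smul_smul, mul_inv_cancel₀ hσ.ne', one_smul]
        have h1 := h w hw
        rw [real_inner_comm, inner_sub_left] at h1
        rw [e, inner_smul_right, inner_smul_right]
        exact_mod_cast mul_le_mul_of_nonneg_left (sub_nonpos.1 h1) hσ.le
      · simp [indicator, if_neg hw]
    · refine le_trans ?_ (le_iSup _ p)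
      simp [indicator, if_pos hp]
  have hlow : ∀ w, ((inner ℝ p w : ℝ) : EReal) ≤ conjugate (indicator K) w := by
    intro w
    refine le_trans ?_ (le_iSup _ p)
    simp [indicator, if_pos hp]
  -- Completing the square: the linear minorant plus the quadratic term has its strict minimum at
  -- `u`.
  have hval : ∀ w, (inner ℝ p w : ℝ) + 1 / (2 * σ) * ‖w - v‖ ^ 2 =
      inner ℝ p u + 1 / (2 * σ) * ‖u - v‖ ^ 2 + 1 / (2 * σ) * ‖w - u‖ ^ 2 := by
    intro w
    have e : w - v = (w - u) - σ • p := by rw [hu]; abel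
    have e2 : u - v = -(σ • p) := by rw [hu]; abel
    have e3 : (inner ℝ p w : ℝ) = inner ℝ p u + inner ℝ (w - u) p := by
      rw [inner_sub_left, real_inner_comm p w, real_inner_comm p u]; ring
    rw [e, e2, norm_neg, norm_sub_sq_real, inner_smul_right, e3]
    field_simp
    ring
  have hpos : 0 < 1 / (2 * σ) := by positivity
  ext z
  simp only [prox, Set.mem_ofPred_eq, Set.mem_singleton_iff]
  constructor
  · intro hz
    have h1 := (add_le_add_left (hlow z) _).trans (hz u)
    rw [hconj] at h1
    have h2 : (inner ℝ p z : ℝ) + 1 / (2 * σ) * ‖z - v‖ ^ 2 ≤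
      inner ℝ p u + 1 / (2 * σ) * ‖u - v‖ ^ 2 := by exact_mod_cast h1
    rw [hval z] at h2
    have h3 : ‖z - u‖ ^ 2 ≤ 0 := by
      by_contra! hc
      have := mul_pos hpos hc
      linarith
    have h4 := le_antisymm h3 (sq_nonneg _)
    exact sub_eq_zero.1 (norm_eq_zero.1 (pow_eq_zero_iff two_ne_zero |>.1 h4))
  · rintro rfl w
    rw [hconj]
    refine le_trans ?_ (add_le_add_left (hlow w) _)
    have := hval w
    have h2 : 0 ≤ 1 / (2 * σ) * ‖w - u‖ ^ 2 := by positivity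
    have h3 : (inner ℝ p u : ℝ) + 1 / (2 * σ) * ‖u - v‖ ^ 2 ≤
      inner ℝ p w + 1 / (2 * σ) * ‖w - v‖ ^ 2 := by linarith
    exact_mod_cast h3

/-! ### Existence and uniqueness of proximal points. -/

theorem IsConvexFun.le_of_le {f : V → EReal} (hf : IsConvexFun f) {u w : V} {r s a b : ℝ}
    (hu : f u ≤ r) (hw : f w ≤ s) (ha : 0 ≤ a) (hb : 0 ≤ b) (hab : a + b = 1) :
    f (a • u + b • w) ≤ ((a * r + b * s : ℝ) : EReal) := by
  have := hf (x := (u, r)) hu (y := (w, s)) hw ha hb hab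
  simpa using this

/-- A proper convex function which is lower semicontinuous on a finite-dimensional space decreases
at most linearly. -/
theorem exists_linear_lower_bound [FiniteDimensional ℝ V] {f : V → EReal} (hp : IsProper f)
    (hc : IsConvexFun f) (hl : LowerSemicontinuous f) (u₀ : V) (hu₀ : f u₀ ≠ ⊤) :
    ∃ A : ℝ, 0 ≤ A ∧ ∀ u, ((-(A * (1 + ‖u - u₀‖)) : ℝ) : EReal) ≤ f u := by
  obtain ⟨z, hz, hmin⟩ := (hl.lowerSemicontinuousOn (Metric.closedBall u₀ 1)).exists_isMinOn
    ⟨u₀, by simp⟩ (isCompact_closedBall u₀ 1)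
  have hmin' : ∀ u ∈ Metric.closedBall u₀ 1, f z ≤ f u := fun u hu => hmin hu
  have hzt : f z ≠ ⊤ := ne_top_of_le_ne_top hu₀ (hmin' u₀ (by simp))
  obtain ⟨c, hcz⟩ : ∃ c : ℝ, f z = c := ⟨_, (EReal.coe_toReal hzt (hp.1 z)).symm⟩
  obtain ⟨e, he⟩ : ∃ e : ℝ, f u₀ = e := ⟨_, (EReal.coe_toReal hu₀ (hp.1 u₀)).symm⟩
  refine ⟨|c| + |e|, by positivity, fun u => ?_⟩
  set r := ‖u - u₀‖ with hr
  have hr0 : 0 ≤ r := norm_nonneg _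
  by_cases h1 : r ≤ 1
  · refine le_trans ?_ (hmin' u (by simpa [dist_eq_norm] using h1))
    rw [hcz]
    have : -((|c| + |e|) * (1 + r)) ≤ c := by
      nlinarith [neg_abs_le c, abs_nonneg c, abs_nonneg e, mul_nonneg (abs_nonneg c) hr0,
        mul_nonneg (abs_nonneg e) hr0]
    exact_mod_cast this
  · push Not at h1
    by_cases hut : f u = ⊤
    · rw [hut]; exact le_top
    obtain ⟨t, ht⟩ : ∃ t : ℝ, f u = t := ⟨_, (EReal.coe_toReal hut (hp.1 u)).symm⟩
    have hrpos : 0 < r := by linarith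
    have hri : r⁻¹ ≤ 1 := inv_le_one_of_one_le₀ h1.le
    -- Weight `r⁻¹` on `u` gives the point where the segment from `u₀` to `u` leaves the unit ball,
    -- where `f ≥ c`; solving for `f u` gives a bound linear in `r`.
    have hconv := hc.le_of_le he.le ht.le (sub_nonneg.2 hri) (inv_nonneg.2 hr0) (by ring)
    have hmem : (1 - r⁻¹) • u₀ + r⁻¹ • u ∈ Metric.closedBall u₀ 1 := by
      have e1 : (1 - r⁻¹) • u₀ + r⁻¹ • u - u₀ = r⁻¹ • (u - u₀) := by module
      rw [Metric.mem_closedBall, dist_eq_norm, e1, norm_smul, ← hr, Real.norm_eq_abs, abs_inv,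
        abs_of_pos hrpos, inv_mul_cancel₀ hrpos.ne']
    have h2 := (hmin' _ hmem).trans hconv
    rw [hcz] at h2
    have h3 : c ≤ (1 - r⁻¹) * e + r⁻¹ * t := by exact_mod_cast h2
    have h4 : r * c ≤ (r - 1) * e + t := by
      have := mul_le_mul_of_nonneg_left h3 hr0
      have e2 : r * ((1 - r⁻¹) * e + r⁻¹ * t) = (r - 1) * e + t := by
        field_simp
      linarith
    rw [ht]
    have : -((|c| + |e|) * (1 + r)) ≤ t := by
      nlinarith [neg_abs_le c, le_abs_self e, abs_nonneg c, abs_nonneg e,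
        mul_le_mul_of_nonneg_left (neg_abs_le c) hr0,
        mul_le_mul_of_nonneg_left (le_abs_self e) (sub_nonneg.2 h1.le)]
    exact_mod_cast this

/-- Uniqueness of proximal points of proper convex functions. -/
theorem prox_subsingleton {f : V → EReal} (hp : IsProper f) (hc : IsConvexFun f) {τ : ℝ}
    (hτ : 0 < τ) (v : V) : (prox τ f v).Subsingleton := by
  obtain ⟨u₀, hu₀⟩ := hp.2
  have hfin : ∀ u ∈ prox τ f v, ∃ r : ℝ, f u = r := by
    intro u hu
    refine ⟨_, (EReal.coe_toReal ?_ (hp.1 u)).symm⟩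
    intro htop
    have h1 := hu u₀
    rw [htop, EReal.top_add_coe, top_le_iff] at h1
    exact (EReal.add_lt_top hu₀ (EReal.coe_ne_top _)).ne h1
  intro u hu w hw
  obtain ⟨r, hr⟩ := hfin u hu
  obtain ⟨s, hs⟩ := hfin w hw
  have hconv := hc.le_of_le hr.le hs.le (a := 1 / 2) (b := 1 / 2) (by norm_num) (by norm_num)
    (by norm_num)
  have hm : ∀ z ∈ prox τ f v, ∀ t : ℝ, f z = t →
      t + 1 / (2 * τ) * ‖z - v‖ ^ 2 ≤ 1 / 2 * r + 1 / 2 * s +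
        1 / (2 * τ) * ‖(1 / 2 : ℝ) • u + (1 / 2 : ℝ) • w - v‖ ^ 2 := by
    intro z hz t ht
    have h1 := (hz _).trans (add_le_add_left hconv _)
    rw [ht] at h1
    exact_mod_cast h1
  have h1 := hm u hu r hr
  have h2 := hm w hw s hs
  -- Parallelogram law: the midpoint of two distinct minimisers would do strictly better.
  have hpar : ‖(1 / 2 : ℝ) • u + (1 / 2 : ℝ) • w - v‖ ^ 2 =
      1 / 2 * ‖u - v‖ ^ 2 + 1 / 2 * ‖w - v‖ ^ 2 - 1 / 4 * ‖u - w‖ ^ 2 := by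
    have e1 : (1 / 2 : ℝ) • u + (1 / 2 : ℝ) • w - v = (1 / 2 : ℝ) • ((u - v) + (w - v)) := by
      module
    have e2 : u - w = (u - v) - (w - v) := by abel
    rw [e1, norm_smul, e2, mul_pow, norm_add_sq_real, norm_sub_sq_real (u - v) (w - v)]
    norm_num
    ring
  rw [hpar] at h1 h2
  have hpos : 0 < 1 / (2 * τ) := by positivity
  have h3 : ‖u - w‖ ^ 2 ≤ 0 := by
    by_contra! hcon
    have := mul_pos hpos hcon
    nlinarith
  have h4 := le_antisymm h3 (sq_nonneg _)
  exact sub_eq_zero.1 (norm_eq_zero.1 (pow_eq_zero_iff two_ne_zero |>.1 h4))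

/-- Existence of proximal points of proper convex lower semicontinuous functions. -/
theorem prox_nonempty [FiniteDimensional ℝ V] {f : V → EReal} (hp : IsProper f)
    (hc : IsConvexFun f) (hl : LowerSemicontinuous f) {τ : ℝ} (hτ : 0 < τ) (v : V) :
    (prox τ f v).Nonempty := by
  obtain ⟨u₀, hu₀⟩ := hp.2
  obtain ⟨A, hA, hbound⟩ := exists_linear_lower_bound hp hc hl u₀ hu₀
  obtain ⟨e, he⟩ : ∃ e : ℝ, f u₀ = e := ⟨_, (EReal.coe_toReal hu₀ (hp.1 u₀)).symm⟩
  set h : V → EReal := fun u => f u + ((1 / (2 * τ) * ‖u - v‖ ^ 2 : ℝ) : EReal) with hh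
  have hlsc : LowerSemicontinuous h := by
    refine hl.add' (Continuous.lowerSemicontinuous ?_) fun x => ?_
    · exact continuous_coe_real_ereal.comp (by fun_prop)
    · exact EReal.continuousAt_add (Or.inr (EReal.coe_ne_bot _)) (Or.inr (EReal.coe_ne_top _))
  -- outside a large ball the quadratic term dominates
  set ρ := ‖u₀ - v‖
  set c := 1 / (2 * τ) with hcdef
  have hcpos : 0 < c := by positivity
  obtain ⟨R, hR0, hR⟩ : ∃ R : ℝ, 0 ≤ R ∧ ∀ t, R < t →
      e + c * ρ ^ 2 < -(A * (1 + (t + ρ))) + c * t ^ 2 := by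
    -- This makes `t > 1` and `c t` larger than the numerator; multiplying the latter by `t` gives
    -- the claim.
    refine ⟨1 + (A + |e| + c * ρ ^ 2 + A * (1 + ρ)) / c, by positivity, fun t ht => ?_⟩
    have h1 : 1 < t := lt_of_le_of_lt (le_add_of_nonneg_right (by positivity)) ht
    have h2 : A + |e| + c * ρ ^ 2 + A * (1 + ρ) < c * t := by
      have h3 : (A + |e| + c * ρ ^ 2 + A * (1 + ρ)) / c < t := by linarith
      rw [div_lt_iff₀ hcpos] at h3
      linarith
    have h3 : 0 ≤ |e| + c * ρ ^ 2 + A * (1 + ρ) := by positivity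
    nlinarith [le_abs_self e, mul_le_mul_of_nonneg_right h2.le (by linarith : 0 ≤ t),
      mul_le_mul_of_nonneg_left h1.le h3]
  -- The ball must contain `u₀`. Otherwise `hR` at `t = ρ` would give `e < -A`, against the linear
  -- bound at `u₀`.
  have hρ : ρ ≤ R := by
    by_contra! hcon
    have h1 := hR ρ hcon
    have h2 := hbound u₀
    rw [he] at h2
    have h3 : -(A * (1 + ‖u₀ - u₀‖)) ≤ e := by exact_mod_cast h2
    have h4 := mul_nonneg hA (norm_nonneg (u₀ - v))
    simp only [sub_self, norm_zero] at h3
    nlinarith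
  obtain ⟨z, hz, hmin⟩ := (hlsc.lowerSemicontinuousOn (Metric.closedBall v R)).exists_isMinOn
    ⟨u₀, by simpa [dist_eq_norm] using hρ⟩ (isCompact_closedBall v R)
  refine ⟨z, fun w => ?_⟩
  by_cases hw : ‖w - v‖ ≤ R
  · exact hmin (a := w) (by simpa [dist_eq_norm] using hw)
  · push Not at hw
    refine (hmin (a := u₀) (by simpa [dist_eq_norm] using hρ)).trans ?_
    simp only [hh, he]
    refine le_trans ?_ (add_le_add_left (hbound w) _)
    have h1 := hR _ hw
    have h2 : ‖w - u₀‖ ≤ ‖w - v‖ + ρ := by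
      have := norm_sub_le (w - v) (u₀ - v)
      simpa using this
    have h3 := mul_le_mul_of_nonneg_left h2 hA
    have h4 : e + c * ρ ^ 2 ≤ -(A * (1 + ‖w - u₀‖)) + c * ‖w - v‖ ^ 2 := by nlinarith
    exact_mod_cast h4

theorem exists_prox_eq_singleton [FiniteDimensional ℝ V] {f : V → EReal} (hp : IsProper f)
    (hc : IsConvexFun f) (hl : LowerSemicontinuous f) {τ : ℝ} (hτ : 0 < τ) (v : V) :
    ∃ p, prox τ f v = {p} := by
  obtain ⟨p, hmem⟩ := prox_nonempty hp hc hl hτ v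
  exact ⟨p, (prox_subsingleton hp hc hτ v).eq_singleton_of_mem hmem⟩

end ConvexAnalysis

end TwoStageARO
namespace TwoStageARO

/-! ### Pseudo-moment functionals and Jensen's inequality. -/

section Moments

open MvPolynomial

variable {d : ℕ}

/-! ### Degrees -/

theorem totalDegree_pderiv_le {ι R : Type*} [CommSemiring R] (i : ι) (p : MvPolynomial ι R) :
    (pderiv i p).totalDegree ≤ p.totalDegree - 1 := by
  classical
  rw [p.as_sum, map_sum, ← p.as_sum]
  refine totalDegree_finsetSum_le fun α hα => ?_
  rw [pderiv_monomial]
  by_cases h : α i = 0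
  · simp [h]
  refine (totalDegree_monomial_le _ _).trans ?_
  have h1 : Finsupp.single i 1 ≤ α := by
    rw [Finsupp.single_le_iff]; omega
  have h2 : (α - Finsupp.single i 1).degree + 1 = α.degree := by
    conv_rhs => rw [← tsub_add_cancel_of_le h1]
    simp
  have h3 : α.degree ≤ p.totalDegree := le_totalDegree hα
  change (α - Finsupp.single i 1).degree ≤ _
  omega

theorem totalDegree_aeval_le {ι κ R : Type*} [CommSemiring R] (φ : ι → MvPolynomial κ R)
    (hφ : ∀ i, (φ i).totalDegree ≤ 1) (p : MvPolynomial ι R) :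
    (aeval φ p).totalDegree ≤ p.totalDegree := by
  classical
  rw [aeval_def, eval₂_eq]
  refine totalDegree_finsetSum_le fun α hα => ?_
  refine (totalDegree_mul _ _).trans ?_
  rw [algebraMap_eq, totalDegree_C, zero_add]
  refine (totalDegree_finsetProd _ _).trans ?_
  refine le_trans (Finset.sum_le_sum fun i _ => ?_) (le_totalDegree hα)
  exact (totalDegree_pow _ _).trans (by simpa using Nat.mul_le_mul_left _ (hφ i))

/-- There is no cancellation of leading terms in a sum of squares. -/
theorem two_mul_totalDegree_le_of_sum_sq {ι κ : Type*} [Finite ι] [Fintype κ]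
    (Q : κ → MvPolynomial ι ℝ) (k : κ) :
    2 * (Q k).totalDegree ≤ (∑ i, Q i ^ 2).totalDegree := by
  classical
  have := Fintype.ofFinite ι
  obtain ⟨_⟩ : Nonempty (LinearOrder ι) := ⟨linearOrderOfSTO WellOrderingRel⟩
  -- A graded order, so that leading exponents realise total degrees.
  let m : MonomialOrder ι := MonomialOrder.degLex
  obtain ⟨i₀, -, hi₀⟩ := Finset.exists_max_image Finset.univ
    (fun i => m.toSyn (m.degree (Q i))) ⟨k, Finset.mem_univ k⟩
  have htd : (Q k).totalDegree ≤ (Q i₀).totalDegree :=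
    MvPolynomial.degLex_totalDegree_monotone (hi₀ k (Finset.mem_univ k))
  by_cases h0 : Q i₀ = 0
  · rw [h0, totalDegree_zero] at htd
    omega
  set a := m.degree (Q i₀) with ha
  -- Since `a` dominates every leading exponent, only `a + a` itself contributes; the sum of real
  -- squares cannot vanish.
  have hcoeff : (∑ i, Q i ^ 2).coeff (a + a) = ∑ i, (Q i).coeff a ^ 2 := by
    rw [coeff_sum]
    refine Finset.sum_congr rfl fun i hi => ?_
    rw [sq, sq, m.coeff_mul_of_add_of_degree_le (hi₀ i hi) (hi₀ i hi)]
  have hpos : 0 < ∑ i, (Q i).coeff a ^ 2 :=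
    Finset.sum_pos' (fun i _ => sq_nonneg _)
      ⟨i₀, Finset.mem_univ _, by
        have := m.coeff_degree_ne_zero_iff.2 h0
        positivity⟩
  have hsupp : a + a ∈ (∑ i, Q i ^ 2).support := by
    rw [mem_support_iff, hcoeff]; exact hpos.ne'
  have h1 : (a + a).degree ≤ (∑ i, Q i ^ 2).totalDegree := le_totalDegree hsupp
  have h2 : a.degree = (Q i₀).totalDegree := MvPolynomial.degree_degLexDegree
  rw [map_add, h2] at h1
  omega

/-! ### The Riesz functional -/

/-- The Riesz functional as a linear map. -/
noncomputable def rieszLinear {n : ℕ} (y : MultiIndex d n → ℝ) :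
    MvPolynomial (Fin d) ℝ →ₗ[ℝ] ℝ where
  toFun := riesz y
  map_add' p q := by simp [riesz, add_mul, Finset.sum_add_distrib]
  map_smul' c p := by simp [riesz, Finset.mul_sum, mul_assoc]

theorem rieszLinear_apply {n : ℕ} (y : MultiIndex d n → ℝ) (p : MvPolynomial (Fin d) ℝ) :
    rieszLinear y p = riesz y p := rfl

theorem riesz_monomial {n : ℕ} (y : MultiIndex d n → ℝ) (α : MultiIndex d n) (c : ℝ) :
    riesz y (monomial α.1 c) = c * y α := by
  classical
  rw [riesz, Finset.sum_eq_single α]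
  · simp
  · intro β _ hβ
    rw [coeff_monomial, if_neg (fun h => hβ (Subtype.ext h).symm), zero_mul]
  · simp

theorem riesz_C {n : ℕ} {y : MultiIndex d n → ℝ} (hy : y (MultiIndex.zero d n) = 1) (c : ℝ) :
    rieszLinear y (C c) = c := by
  have := riesz_monomial y (MultiIndex.zero d n) c
  rw [hy, mul_one] at this
  exact this

theorem riesz_X {n : ℕ} (hn : 2 ≤ n) (y : MultiIndex d n → ℝ) (i : Fin d) :
    rieszLinear y (X i) = firstMoments hn y i := by
  have := riesz_monomial y (MultiIndex.unit hn i) 1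
  rw [one_mul] at this
  exact this

/-- A polynomial of degree at most `n` as a sum over the multi-indices of degree at most `n`. -/
theorem sum_monomial_coeff {n : ℕ} {p : MvPolynomial (Fin d) ℝ} (hp : p.totalDegree ≤ n) :
    ∑ α : MultiIndex d n, monomial α.1 (p.coeff α.1) = p := by
  classical
  ext β
  rw [coeff_sum]
  by_cases hβ : β.degree ≤ n
  · rw [Finset.sum_eq_single ⟨β, hβ⟩]
    · simp
    · intro α _ hα
      rw [coeff_monomial, if_neg fun h => hα (Subtype.ext h)]
    · simp
  · rw [Finset.sum_eq_zero, coeff_eq_zero_of_totalDegree_lt]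
    · exact lt_of_le_of_lt hp (not_le.1 hβ)
    · intro α _
      rw [coeff_monomial, if_neg]
      rintro rfl
      exact hβ α.2

/-- The entries of the moment matrix. -/
theorem sum_smul_momentBasis_apply {n : ℕ} (y : MultiIndex d n → ℝ)
    (β γ : MultiIndex d (n / 2)) :
    (∑ α, y α • momentBasis α) β γ = riesz y (monomial β.1 1 * monomial γ.1 1) := by
  classical
  rw [monomial_mul, riesz, Matrix.sum_apply]
  refine Finset.sum_congr rfl fun α _ => ?_
  simp [momentBasis, coeff_monomial]

theorem riesz_sq_eq {n : ℕ} (y : MultiIndex d n → ℝ) {p : MvPolynomial (Fin d) ℝ}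
    (hp : p.totalDegree ≤ n / 2) :
    riesz y (p ^ 2) = (fun β : MultiIndex d (n / 2) => p.coeff β.1) ⬝ᵥ
      (∑ α, y α • momentBasis α).mulVec fun β => p.coeff β.1 := by
  conv_lhs => rw [← sum_monomial_coeff hp, sq, Finset.sum_mul_sum, ← rieszLinear_apply]
  simp only [map_sum, dotProduct, Matrix.mulVec, Finset.mul_sum]
  refine Finset.sum_congr rfl fun β _ => Finset.sum_congr rfl fun γ _ => ?_
  rw [sum_smul_momentBasis_apply, ← rieszLinear_apply, monomial_mul, monomial_mul,
    show monomial (β.1 + γ.1) (p.coeff β.1 * p.coeff γ.1) =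
      (p.coeff β.1 * p.coeff γ.1) • monomial (β.1 + γ.1) (1 * 1 : ℝ) by
        rw [smul_monomial]; simp,
    map_smul, smul_eq_mul]
  ring

/-- On squares of polynomials of degree at most `n / 2` the functional is the quadratic form of the
moment matrix in the coefficient vector. -/
theorem riesz_sq_nonneg {n : ℕ} {y : MultiIndex d n → ℝ}
    (hy : (∑ α, y α • momentBasis α).PosSemidef) {p : MvPolynomial (Fin d) ℝ}
    (hp : p.totalDegree ≤ n / 2) : 0 ≤ riesz y (p ^ 2) := by
  rw [riesz_sq_eq y hp]
  simpa using hy.dotProduct_mulVec_nonneg fun β => p.coeff β.1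

/-! ### Jensen's inequality for SOS-convex polynomials -/

/-- The polynomial `p(u + t (x - u))` in the variable `x`. -/
noncomputable def segment (u : Fin d → ℝ) (t : ℝ) :
    MvPolynomial (Fin d) ℝ →ₐ[ℝ] MvPolynomial (Fin d) ℝ :=
  aeval fun i => C (u i) + C t * (X i - C (u i))

theorem segment_zero (u : Fin d → ℝ) (p : MvPolynomial (Fin d) ℝ) :
    segment u 0 p = C (eval u p) := by
  simp only [segment, C_0, zero_mul, add_zero]
  have := aeval_algebraMap_apply (MvPolynomial (Fin d) ℝ) u p
  rw [aeval_eq_eval] at this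
  exact this

theorem segment_one (u : Fin d → ℝ) (p : MvPolynomial (Fin d) ℝ) : segment u 1 p = p := by
  simp [segment]

theorem totalDegree_X_sub_C_le (u : ℝ) (i : Fin d) :
    (X i - C u : MvPolynomial (Fin d) ℝ).totalDegree ≤ 1 :=
  (totalDegree_sub_C_le _ _).trans (totalDegree_X i).le

theorem totalDegree_segment_le (u : Fin d → ℝ) (t : ℝ) (p : MvPolynomial (Fin d) ℝ) :
    (segment u t p).totalDegree ≤ p.totalDegree := by
  refine totalDegree_aeval_le _ (fun i => ?_) p
  refine (totalDegree_add _ _).trans (max_le (by simp) ((totalDegree_mul _ _).trans ?_))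
  rw [totalDegree_C, zero_add]
  exact totalDegree_X_sub_C_le _ _

/-- The chain rule along a segment, tested against a linear functional. -/
theorem hasDerivAt_segment (u : Fin d → ℝ) (p : MvPolynomial (Fin d) ℝ)
    (L : MvPolynomial (Fin d) ℝ →ₗ[ℝ] ℝ) (t : ℝ) :
    HasDerivAt (fun t => L (segment u t p))
      (L (∑ i, segment u t (pderiv i p) * (X i - C (u i)))) t := by
  induction p using MvPolynomial.induction_on generalizing L with
  | C a =>
    simpa [segment] using hasDerivAt_const t (L (algebraMap ℝ _ a))
  | add p q hp hq =>
    have := (hp L).add (hq L)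
    simp only [map_add, add_mul, Finset.sum_add_distrib] at this ⊢
    exact this
  | mul_X p j hp =>
    -- The factor `X j` becomes `u j + t (X j - u j)` on the segment; multiplication by `X j - u j`
    -- is absorbed into the functional, hence the induction over all `L`.
    have h1 := (hp L).const_mul (u j)
    have h2 := (hasDerivAt_id t).mul (hp (L ∘ₗ LinearMap.mulRight ℝ (X j - C (u j))))
    have h := h1.add h2
    have hX : ∀ s, segment u s (X j) = C (u j) + C s * (X j - C (u j)) := by
      intro s; simp [segment]
    have hC : ∀ (c : ℝ) (r : MvPolynomial (Fin d) ℝ), L (C c * r) = c * L r := by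
      intro c r; rw [C_mul', map_smul, smul_eq_mul]
    refine (h.congr_deriv ?_).congr_of_eventuallyEq (Filter.Eventually.of_forall fun s => ?_)
    · simp only [LinearMap.comp_apply, LinearMap.mulRight_apply, id]
      rw [one_mul, ← hC, ← hC, ← map_add, ← map_add]
      congr 1
      simp only [pderiv_mul, pderiv_X, map_add, map_mul, hX, add_mul, Finset.sum_add_distrib]
      have : ∑ i, segment u t p *
          segment u t (Pi.single (M := fun _ => MvPolynomial (Fin d) ℝ) i 1 j) * (X i - C (u i)) =
          segment u t p * (X j - C (u j)) := by
        rw [Finset.sum_eq_single j]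
        · simp
        · intro i _ hi
          rw [Pi.single_eq_of_ne (Ne.symm hi)]; simp
        · simp
      rw [this, Finset.mul_sum, Finset.sum_mul, Finset.mul_sum]
      rw [add_left_comm, add_comm (segment u t p * _), ← Finset.sum_add_distrib]
      congr 1
      refine Finset.sum_congr rfl fun i _ => ?_
      ring
    · simp only [LinearMap.comp_apply, LinearMap.mulRight_apply, id, map_mul, hX,
        Pi.add_apply, Pi.mul_apply]
      rw [← hC, ← hC, ← map_add]
      congr 1
      ring

/-- The left side is the second derivative of `p` along the segment; the factorisation of the
Hessian exhibits it as a sum of squares. -/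
theorem hessian_form_eq_sum_sq {p : MvPolynomial (Fin d) ℝ} {ν : ℕ}
    {P : Matrix (Fin ν) (Fin d) (MvPolynomial (Fin d) ℝ)} (hP : hessian p = P.transpose * P)
    (u : Fin d → ℝ) (t : ℝ) :
    ∑ i, (∑ j, segment u t (pderiv j (pderiv i p)) * (X j - C (u j))) * (X i - C (u i)) =
      ∑ κ, (∑ i, segment u t (P κ i) * (X i - C (u i))) ^ 2 := by
  have h : ∀ i j, pderiv j (pderiv i p) = ∑ κ, P κ j * P κ i := by
    intro i j
    have := congrFun (congrFun hP j) i
    simpa [hessian, Matrix.mul_apply] using this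
  simp only [h, map_sum, map_mul, sq, Finset.sum_mul, Finset.mul_sum]
  rw [Finset.sum_comm' (t' := Finset.univ) (s' := fun _ => Finset.univ) (by simp)]
  rw [Finset.sum_congr rfl fun _ _ => Finset.sum_comm, Finset.sum_comm]
  refine Finset.sum_congr rfl fun κ _ => Finset.sum_congr rfl fun j _ =>
    Finset.sum_congr rfl fun i _ => ?_
  ring

/-- Jensen's inequality: the value at the vector of first moments is at most the Riesz
functional. -/
theorem eval_firstMoments_le_riesz {n : ℕ} (hn : 2 ≤ n) (hev : Even n) {y : MultiIndex d n → ℝ}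
    (hy : (∑ α, y α • momentBasis α).PosSemidef) (hy0 : y (MultiIndex.zero d n) = 1)
    {p : MvPolynomial (Fin d) ℝ} (hp : IsSOSConvex p) (hdeg : p.totalDegree ≤ n) :
    eval (fun i => firstMoments hn y i) p ≤ riesz y p := by
  obtain ⟨ν, P, hP⟩ := hp
  set u : Fin d → ℝ := fun i => firstMoments hn y i with hu
  set L := rieszLinear y
  set φ : ℝ → ℝ := fun t => L (segment u t p)
  set φ' : ℝ → ℝ := fun t => L (∑ i, segment u t (pderiv i p) * (X i - C (u i)))
  set Q : ℝ → MvPolynomial (Fin d) ℝ := fun t =>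
    ∑ κ, (∑ i, segment u t (P κ i) * (X i - C (u i))) ^ 2 with hQ
  have h1 : ∀ t, HasDerivAt φ (φ' t) t := hasDerivAt_segment u p L
  have h2 : ∀ t, HasDerivAt φ' (L (Q t)) t := by
    intro t
    have h := HasDerivAt.fun_sum (u := Finset.univ) fun i _ =>
      hasDerivAt_segment u (pderiv i p) (L ∘ₗ LinearMap.mulRight ℝ (X i - C (u i))) t
    simp only [LinearMap.comp_apply, LinearMap.mulRight_apply] at h
    simp only [← map_sum] at h
    rw [hessian_form_eq_sum_sq hP u t] at h
    exact h
  -- No degree bound on `P` is given. The Hessian form bounds the whole sum by `n`, as two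
  -- derivatives offset two linear factors, and absence of cancellation then bounds each squared
  -- polynomial by `n / 2`.
  have hQdeg : ∀ t, (Q t).totalDegree ≤ n := by
    intro t
    simp only [hQ]
    rw [← hessian_form_eq_sum_sq hP u t]
    refine totalDegree_finsetSum_le fun i _ => (totalDegree_mul _ _).trans ?_
    have ha : (∑ j, segment u t (pderiv j (pderiv i p)) * (X j - C (u j))).totalDegree ≤ n - 1 := by
      refine totalDegree_finsetSum_le fun j _ => (totalDegree_mul _ _).trans ?_
      have e1 := totalDegree_segment_le u t (pderiv j (pderiv i p))
      have e2 := totalDegree_pderiv_le j (pderiv i p)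
      have e3 := totalDegree_pderiv_le i p
      have e4 := totalDegree_X_sub_C_le (u j) j
      omega
    have hb := totalDegree_X_sub_C_le (u i) i
    omega
  have h3 : ∀ t, 0 ≤ L (Q t) := by
    intro t
    simp only [hQ, map_sum]
    refine Finset.sum_nonneg fun κ _ => riesz_sq_nonneg hy ?_
    have e1 := two_mul_totalDegree_le_of_sum_sq
      (fun κ => ∑ i, segment u t (P κ i) * (X i - C (u i))) κ
    have e2 := hQdeg t
    simp only [hQ] at e2
    obtain ⟨r, rfl⟩ := hev
    omega
  have hmono : Monotone φ' := monotone_of_hasDerivAt_nonneg h2 h3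
  -- At `t = 0` the derivatives are constants, and the functional kills `X i - u i` because `u`
  -- consists of the first moments.
  have h0 : φ' 0 = 0 := by
    simp only [φ', map_sum, segment_zero]
    refine Finset.sum_eq_zero fun i _ => ?_
    rw [C_mul', map_smul, map_sub, riesz_X hn, riesz_C hy0]
    simp [hu]
  have hconv : φ 0 ≤ φ 1 := by
    refine monotoneOn_of_deriv_nonneg (convex_Icc 0 1)
      (fun t _ => (h1 t).continuousAt.continuousWithinAt)
      (fun t _ => (h1 t).differentiableAt.differentiableWithinAt) (fun t ht => ?_)
      (by simp) (by simp) zero_le_one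
    rw [(h1 t).deriv, ← h0]
    rw [interior_Icc] at ht
    exact hmono ht.1.le
  simp only [φ, segment_zero, segment_one, L, riesz_C hy0] at hconv
  exact hconv

end Moments

end TwoStageARO
namespace TwoStageARO

section MomentProgram

open MvPolynomial

variable {d s : ℕ}

/-! ### The moment program -/

/-- The moments of the Dirac measure at `x`. -/
noncomputable def diracMoments (n : ℕ) (x : EuclideanSpace ℝ (Fin d)) : MultiIndex d n → ℝ :=
  fun α => eval (fun i => x i) (monomial α.1 1)

theorem riesz_diracMoments {n : ℕ} (x : EuclideanSpace ℝ (Fin d)) {p : MvPolynomial (Fin d) ℝ}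
    (hp : p.totalDegree ≤ n) : riesz (diracMoments n x) p = eval (fun i => x i) p := by
  conv_rhs => rw [← sum_monomial_coeff hp, map_sum]
  refine Finset.sum_congr rfl fun α _ => ?_
  rw [diracMoments, eval_monomial, eval_monomial, one_mul]

theorem firstMoments_diracMoments {n : ℕ} (hn : 2 ≤ n) (x : EuclideanSpace ℝ (Fin d)) :
    firstMoments hn (diracMoments n x) = x := by
  ext i
  simp [firstMoments, diracMoments, MultiIndex.unit, eval_monomial]

theorem isMomentFeasible_diracMoments {n : ℕ} {g : Fin s → MvPolynomial (Fin d) ℝ}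
    (hdeg : ∀ j, (g j).totalDegree ≤ n) {x : EuclideanSpace ℝ (Fin d)} (hx : x ∈ feasibleSet g) :
    IsMomentFeasible g (diracMoments n x) := by
  refine ⟨fun j => ?_, ?_, ?_⟩
  · rw [riesz_diracMoments x (hdeg j)]
    exact hx j
  -- The moment matrix of a point mass has rank one: the outer product of the vector of monomials at
  -- `x`.
  · have h : ∑ α, diracMoments n x α • momentBasis α = Matrix.vecMulVec
        (fun β : MultiIndex d (n / 2) => eval (fun i => x i) (monomial β.1 1))
        (star fun β : MultiIndex d (n / 2) => eval (fun i => x i) (monomial β.1 1)) := by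
      ext β γ
      rw [sum_smul_momentBasis_apply, riesz_diracMoments, map_mul]
      · simp [Matrix.vecMulVec_apply]
      · rw [monomial_mul]
        refine (totalDegree_monomial_le _ _).trans ?_
        change (β.1 + γ.1).degree ≤ n
        have h1 := β.2
        have h2 := γ.2
        rw [map_add]
        omega
    rw [h]
    exact Matrix.posSemidef_vecMulVec_self_star _
  · simp [diracMoments, MultiIndex.zero]

theorem IsMomentFeasible.firstMoments_mem {n : ℕ} {g : Fin s → MvPolynomial (Fin d) ℝ}
    (hg : ∀ j, IsSOSConvex (g j)) (hn : 2 ≤ n) (hev : Even n)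
    (hdeg : ∀ j, (g j).totalDegree ≤ n) {y : MultiIndex d n → ℝ} (hy : IsMomentFeasible g y) :
    firstMoments hn y ∈ feasibleSet g := fun j =>
  (eval_firstMoments_le_riesz hn hev hy.2.1 hy.2.2 (hg j) (hdeg j)).trans (hy.1 j)

theorem isClosed_feasibleSet (g : Fin s → MvPolynomial (Fin d) ℝ) : IsClosed (feasibleSet g) := by
  simp only [feasibleSet, Set.ofPred_forall]
  refine isClosed_iInter fun j => isClosed_le ?_ continuous_const
  exact (MvPolynomial.continuous_eval (g j)).comp (by fun_prop)

theorem isMomentFeasible_convexCombo {n : ℕ} {g : Fin s → MvPolynomial (Fin d) ℝ}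
    {y z : MultiIndex d n → ℝ} (hy : IsMomentFeasible g y) (hz : IsMomentFeasible g z)
    {a b : ℝ} (ha : 0 ≤ a) (hb : 0 ≤ b) (hab : a + b = 1) :
    IsMomentFeasible g (a • y + b • z) := by
  refine ⟨fun j => ?_, ?_, ?_⟩
  · have h : riesz (a • y + b • z) (g j) = a * riesz y (g j) + b * riesz z (g j) := by
      simp only [riesz, Finset.mul_sum, ← Finset.sum_add_distrib]
      refine Finset.sum_congr rfl fun α _ => ?_
      simp only [Pi.add_apply, Pi.smul_apply, smul_eq_mul]
      ring
    rw [h]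
    have h1 := mul_nonpos_of_nonneg_of_nonpos ha (hy.1 j)
    have h2 := mul_nonpos_of_nonneg_of_nonpos hb (hz.1 j)
    linarith
  · have h : ∑ α, (a • y + b • z) α • momentBasis α =
        a • (∑ α, y α • momentBasis α) + b • ∑ α, z α • momentBasis α := by
      simp only [Finset.smul_sum, ← Finset.sum_add_distrib]
      refine Finset.sum_congr rfl fun α _ => ?_
      simp only [Pi.add_apply, Pi.smul_apply, smul_eq_mul, add_smul, mul_smul]
    rw [h]
    exact (hy.2.1.smul ha).add (hz.2.1.smul hb)
  · simp [hy.2.2, hz.2.2, hab]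

/-- A mixture of two Dirac moment vectors is moment-feasible, and its first moments, the convex
combination of the points, lie in the set by Jensen. -/
theorem convex_feasibleSet {g : Fin s → MvPolynomial (Fin d) ℝ} (hg : ∀ j, IsSOSConvex (g j)) :
    Convex ℝ (feasibleSet g) := by
  obtain ⟨hev, hn, hdeg⟩ := truncOrder_spec g
  intro x hx z hz a b ha hb hab
  have h := (isMomentFeasible_convexCombo (isMomentFeasible_diracMoments hdeg hx)
    (isMomentFeasible_diracMoments hdeg hz) ha hb hab).firstMoments_mem hg hn hev hdeg
  have e : firstMoments hn (a • diracMoments (truncOrder g) x +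
      b • diracMoments (truncOrder g) z) = a • x + b • z := by
    conv_rhs => rw [← firstMoments_diracMoments hn x, ← firstMoments_diracMoments hn z]
    rfl
  rwa [e] at h

theorem totalDegree_sqDistPoly_le (v : EuclideanSpace ℝ (Fin d)) :
    (sqDistPoly v).totalDegree ≤ 2 := by
  refine totalDegree_finsetSum_le fun i _ => ?_
  rw [← neg_sub, neg_sq]
  refine (totalDegree_pow _ _).trans ?_
  have := totalDegree_X_sub_C_le (v i) i
  omega

theorem eval_sqDistPoly (v x : EuclideanSpace ℝ (Fin d)) :
    eval (fun i => x i) (sqDistPoly v) = ‖x - v‖ ^ 2 := by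
  simp only [sqDistPoly, map_sum, map_pow, map_sub, eval_C, eval_X, EuclideanSpace.norm_sq_eq,
    PiLp.sub_apply, Real.norm_eq_abs, sq_abs]
  exact Finset.sum_congr rfl fun i _ => by ring

/-- Each coordinate has nonnegative variance. Expanding around the mean `w` leaves `(v i - w)²` plus
that variance, and the cross term vanishes. -/
theorem norm_firstMoments_sub_sq_le {n : ℕ} (hn : 2 ≤ n) {y : MultiIndex d n → ℝ}
    (hy : (∑ α, y α • momentBasis α).PosSemidef) (hy0 : y (MultiIndex.zero d n) = 1)
    (v : EuclideanSpace ℝ (Fin d)) :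
    ‖firstMoments hn y - v‖ ^ 2 ≤ riesz y (sqDistPoly v) := by
  rw [← rieszLinear_apply, sqDistPoly, map_sum, EuclideanSpace.norm_sq_eq]
  refine Finset.sum_le_sum fun i _ => ?_
  set w := firstMoments hn y i with hw
  have h1 : 0 ≤ rieszLinear y ((X i - C w) ^ 2) :=
    riesz_sq_nonneg hy ((totalDegree_X_sub_C_le w i).trans (by omega))
  have e : (C (v i) - X i : MvPolynomial (Fin d) ℝ) ^ 2 =
      (X i - C w) ^ 2 + C ((v i - w) ^ 2) - (2 * (v i - w)) • (X i - C w) := by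
    rw [← C_mul']
    simp only [map_pow, map_sub, map_mul, map_ofNat]
    ring
  rw [e, map_sub, map_add, map_smul, map_sub, riesz_C hy0, riesz_C hy0, riesz_X hn, ← hw, sub_self,
    smul_zero, sub_zero, PiLp.sub_apply, ← hw, Real.norm_eq_abs, sq_abs]
  linarith [h1, sub_sq_comm w (v i)]

/-- The moment program has a solution, and the first moments of every solution form the projection
onto the feasible set. -/
theorem exists_isMomentSolution_and_proj_eq_firstMoments {g : Fin s → MvPolynomial (Fin d) ℝ} (hg : ∀ j, IsSOSConvex (g j))
    (hne : (feasibleSet g).Nonempty) (v : EuclideanSpace ℝ (Fin d)) :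
    (∃ y : MultiIndex d (truncOrder g) → ℝ, IsMomentSolution g v y) ∧
      ∀ y : MultiIndex d (truncOrder g) → ℝ, IsMomentSolution g v y →
        proj (feasibleSet g) v = {firstMoments (truncOrder_spec g).2.1 y} := by
  obtain ⟨hev, hn, hdeg⟩ := truncOrder_spec g
  obtain ⟨p, hproj, hp, -⟩ :=
    exists_proj_eq_singleton hne (isClosed_feasibleSet g) (convex_feasibleSet hg) v
  have hmin : ∀ w ∈ feasibleSet g, ‖p - v‖ ≤ ‖w - v‖ :=
    (show p ∈ proj (feasibleSet g) v by rw [hproj]; rfl).2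
  have hdirac : riesz (diracMoments (truncOrder g) p) (sqDistPoly v) = ‖p - v‖ ^ 2 := by
    rw [riesz_diracMoments p ((totalDegree_sqDistPoly_le v).trans hn), eval_sqDistPoly]
  have hfeas := isMomentFeasible_diracMoments hdeg hp
  refine ⟨⟨diracMoments _ p, hfeas, fun y hy => ?_⟩, fun y hy => ?_⟩
  · rw [hdirac]
    refine le_trans ?_ (norm_firstMoments_sub_sq_le hn hy.2.1 hy.2.2 v)
    gcongr
    exact hmin _ (hy.firstMoments_mem hg hn hev hdeg)
  -- Comparing an optimal `y` with the Dirac moments at `p` shows that its first moments are no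
  -- farther from `v` than `p` is.
  · have hmem := hy.1.firstMoments_mem hg hn hev hdeg
    have h1 := (norm_firstMoments_sub_sq_le hn hy.1.2.1 hy.1.2.2 v).trans (hy.2 _ hfeas)
    rw [hdirac] at h1
    have h2 : ‖firstMoments hn y - v‖ ≤ ‖p - v‖ := le_of_sq_le_sq h1 (norm_nonneg _)
    have h3 : firstMoments hn y ∈ proj (feasibleSet g) v :=
      ⟨hmem, fun w hw => h2.trans (hmin w hw)⟩
    rw [hproj] at h3 ⊢
    rw [Set.mem_singleton_iff.1 h3]

end MomentProgram

/-! ### Proximal operators on the product spaces -/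

section Products

variable {d q k m : ℕ}

theorem psdCone_nonempty (n : Type*) [Fintype n] : (psdCone n).Nonempty :=
  ⟨0, Matrix.PosSemidef.zero⟩

theorem convex_psdCone (n : Type*) [Fintype n] : Convex ℝ (psdCone n) := by
  intro A hA B hB a b ha hb _
  exact (Matrix.PosSemidef.smul hA ha).add (Matrix.PosSemidef.smul hB hb)

/-- Symmetry is built into the space, so the cone is the intersection of the closed half-spaces `xᵀ
A x ≥ 0`. -/
theorem isClosed_psdCone (n : Type*) [Fintype n] : IsClosed (psdCone n) := by
  have h : psdCone n = ⋂ x : n → ℝ,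
      {A : SymMat n | 0 ≤ ∑ i, x i * ∑ j, (A : Mat n n) (i, j) * x j} := by
    ext A
    simp only [psdCone, Set.mem_ofPred_eq, Set.mem_iInter,
      Matrix.posSemidef_iff_dotProduct_mulVec]
    have hA : (SymMat.toMatrix A).IsHermitian := by
      ext i j
      exact A.2 j i
    exact ⟨fun h x => h.2 x, fun h => ⟨hA, h⟩⟩
  rw [h]
  refine isClosed_iInter fun x => isClosed_le continuous_const ?_
  fun_prop

theorem proj_orthant (l l' : EuclideanSpace ℝ (Fin m)) (hl : ∀ i, l' i = max (l i) 0) :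
    proj (orthant m) l = {l'} := by
  refine proj_eq_singleton_of_inner_nonpos (fun i => by rw [hl]; exact le_max_right _ _)
    fun w hw => ?_
  rw [PiLp.inner_apply]
  refine Finset.sum_nonpos fun i _ => ?_
  have hwi := hw i
  simp only [PiLp.sub_apply, hl i, RCLike.inner_apply, conj_trivial]
  rcases le_total (l i) 0 with h | h
  · rw [max_eq_right h]
    simpa using mul_nonpos_of_nonneg_of_nonpos hwi h
  · rw [max_eq_left h]
    simp

/-- No summand is `⊥`, so a single `⊤` makes the whole sum `⊤`. -/
theorem sum_indicator {ι : Type*} [Fintype ι] {W : ι → Type*} (K : ∀ i, Set (W i))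
    (w : ∀ i, W i) :
    ∑ i, indicator (K i) (w i) = indicator {w : ∀ i, W i | ∀ i, w i ∈ K i} w := by
  classical
  by_cases h : ∀ i, w i ∈ K i
  · simp [indicator, h]
  · rw [indicator, if_neg (by exact h)]
    push Not at h
    obtain ⟨i, hi⟩ := h
    rw [← Finset.add_sum_erase _ _ (Finset.mem_univ i), indicator, if_neg hi]
    refine EReal.top_add_of_ne_bot ?_
    refine Finset.sum_induction _ (· ≠ ⊥) (fun a b ha hb => by simp [EReal.add_eq_bot_iff, ha, hb])
      (by simp) fun j _ => ?_
    unfold indicator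
    split_ifs <;> simp

theorem XSpace.norm_sub_mk_sq (z : XSpace d q k m) (x : EuclideanSpace ℝ (Fin d))
    (y₀ : EuclideanSpace ℝ (Fin q)) (U : Mat (Fin q) (Fin k))
    (Θ : PiLp 2 (fun _ : Fin q => SymMat (Fin k))) (l : EuclideanSpace ℝ (Fin m)) :
    ‖z - XSpace.mk x y₀ U Θ l‖ ^ 2 = ‖z.x - x‖ ^ 2 + (‖z.snd.fst - y₀‖ ^ 2 +
      (‖z.snd.snd.fst - U‖ ^ 2 + (‖z.snd.snd.snd.fst - Θ‖ ^ 2 + ‖z.l - l‖ ^ 2))) := by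
  simp only [WithLp.prod_norm_sq_eq_of_L2]
  rfl

/-- The proximal operator of `F` splits. -/
theorem prox_F {f : EuclideanSpace ℝ (Fin d) → EReal} (hf : IsProper f) {τ : ℝ} (hτ : 0 < τ)
    {x p : EuclideanSpace ℝ (Fin d)} (y₀ : EuclideanSpace ℝ (Fin q)) (U : Mat (Fin q) (Fin k))
    (Θ : PiLp 2 (fun _ : Fin q => SymMat (Fin k))) {l l' : EuclideanSpace ℝ (Fin m)}
    (hp : prox τ f x = {p}) (hl : proj (orthant m) l = {l'}) :
    prox τ (F q k m f) (XSpace.mk x y₀ U Θ l) = {XSpace.mk p y₀ U Θ l'} := by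
  classical
  have hpm : p ∈ prox τ f x := by rw [hp]; rfl
  have hlm : l' ∈ proj (orthant m) l := by rw [hl]; rfl
  have hF : ∀ z : XSpace d q k m, z.l ∈ orthant m → F q k m f z = f z.x := by
    intro z hz
    rw [F, sum_indicator (fun _ => Set.Ici (0 : ℝ)) fun i => z.l i, indicator, if_pos (by exact hz),
      add_zero]
  have hF' : ∀ z : XSpace d q k m, z.l ∉ orthant m → F q k m f z = ⊤ := by
    intro z hz
    rw [F, sum_indicator (fun _ => Set.Ici (0 : ℝ)) fun i => z.l i, indicator, if_neg (by exact hz)]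
    exact EReal.add_top_of_ne_bot (hf.1 _)
  obtain ⟨r, hr⟩ : ∃ r : ℝ, f p = r := by
    refine ⟨_, (EReal.coe_toReal ?_ (hf.1 p)).symm⟩
    intro htop
    obtain ⟨u₀, hu₀⟩ := hf.2
    have h1 := hpm u₀
    rw [htop, EReal.top_add_coe, top_le_iff] at h1
    exact (EReal.add_lt_top hu₀ (EReal.coe_ne_top _)).ne h1
  have hc : 0 < 1 / (2 * τ) := by positivity
  set c := 1 / (2 * τ)
  have hFp : F q k m f (XSpace.mk p y₀ U Θ l') = r := by
    rw [hF (XSpace.mk p y₀ U Θ l') hlm.1, ← hr]; rfl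
  have hnp : ‖XSpace.mk p y₀ U Θ l' - XSpace.mk x y₀ U Θ l‖ ^ 2 = ‖p - x‖ ^ 2 + ‖l' - l‖ ^ 2 := by
    rw [XSpace.norm_sub_mk_sq]
    simp [XSpace.mk, XSpace.x, XSpace.l]
  have hle : ∀ w (t : ℝ), f w = t → r + c * ‖p - x‖ ^ 2 ≤ t + c * ‖w - x‖ ^ 2 := by
    intro w t ht
    have h1 := hpm w
    rw [hr, ht] at h1
    exact_mod_cast h1
  have hll : ∀ w ∈ orthant m, ‖l' - l‖ ^ 2 ≤ ‖w - l‖ ^ 2 := by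
    intro w hw
    gcongr
    exact hlm.2 w hw
  ext z
  rw [Set.mem_singleton_iff]
  constructor
  · intro hz
    have h1 := hz (XSpace.mk p y₀ U Θ l')
    rw [hFp, hnp] at h1
    have hzl : z.l ∈ orthant m := by
      by_contra hcon
      rw [hF' z hcon, EReal.top_add_coe, top_le_iff] at h1
      exact EReal.coe_ne_top _ h1
    rw [hF z hzl] at h1
    obtain ⟨t, ht⟩ : ∃ t : ℝ, f z.x = t := by
      refine ⟨_, (EReal.coe_toReal ?_ (hf.1 _)).symm⟩
      intro htop
      rw [htop, EReal.top_add_coe, top_le_iff] at h1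
      exact EReal.coe_ne_top _ h1
    rw [ht] at h1
    have h2 : t + c * ‖z - XSpace.mk x y₀ U Θ l‖ ^ 2 ≤ r + c * (‖p - x‖ ^ 2 + ‖l' - l‖ ^ 2) := by
      exact_mod_cast h1
    rw [XSpace.norm_sub_mk_sq] at h2
    -- The five blocks have nonnegative excesses over the candidate, and by `h2` their sum is
    -- nonpositive; so each vanishes.
    have h3 := hle _ t ht
    have h4 := mul_le_mul_of_nonneg_left (hll _ hzl) hc.le
    have n1 := mul_nonneg hc.le (sq_nonneg ‖z.snd.fst - y₀‖)
    have n2 := mul_nonneg hc.le (sq_nonneg ‖z.snd.snd.fst - U‖)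
    have n3 := mul_nonneg hc.le (sq_nonneg ‖z.snd.snd.snd.fst - Θ‖)
    simp only [mul_add] at h2
    have zero_of : ∀ {W : Type} [NormedAddCommGroup W] (a b : W), c * ‖a - b‖ ^ 2 ≤ 0 → a = b := by
      intro W _ a b hab
      have : ‖a - b‖ ^ 2 = 0 :=
        le_antisymm (nonpos_of_mul_nonpos_right hab hc) (sq_nonneg _)
      exact sub_eq_zero.1 (norm_eq_zero.1 (pow_eq_zero_iff two_ne_zero |>.1 this))
    have e1 := zero_of z.snd.fst y₀ (by linarith)
    have e2 := zero_of z.snd.snd.fst U (by linarith)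
    have e3 := zero_of z.snd.snd.snd.fst Θ (by linarith)
    have e4 : z.x = p := by
      have : z.x ∈ prox τ f x := by
        intro w
        refine le_trans ?_ (hpm w)
        rw [hr, ht]
        have : t + c * ‖z.x - x‖ ^ 2 ≤ r + c * ‖p - x‖ ^ 2 := by linarith
        exact_mod_cast this
      rwa [hp] at this
    have e5 : z.l = l' := by
      have : z.l ∈ proj (orthant m) l := by
        refine ⟨hzl, fun w hw => le_trans ?_ (hlm.2 w hw)⟩
        refine le_of_sq_le_sq ?_ (norm_nonneg _)
        exact le_of_mul_le_mul_left (by linarith) hc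
      rwa [hl] at this
    rw [← e1, ← e2, ← e3, ← e4, ← e5]
    rfl
  · rintro rfl w
    rw [hFp, hnp]
    by_cases hwl : w.l ∈ orthant m
    · rw [hF w hwl]
      by_cases hwt : f w.x = ⊤
      · rw [hwt, EReal.top_add_coe]; exact le_top
      obtain ⟨t, ht⟩ : ∃ t : ℝ, f w.x = t := ⟨_, (EReal.coe_toReal hwt (hf.1 _)).symm⟩
      rw [ht, XSpace.norm_sub_mk_sq]
      have h3 := hle _ t ht
      have h4 := mul_le_mul_of_nonneg_left (hll _ hwl) hc.le
      have n1 := mul_nonneg hc.le (sq_nonneg ‖w.snd.fst - y₀‖)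
      have n2 := mul_nonneg hc.le (sq_nonneg ‖w.snd.snd.fst - U‖)
      have n3 := mul_nonneg hc.le (sq_nonneg ‖w.snd.snd.snd.fst - Θ‖)
      have : r + c * (‖p - x‖ ^ 2 + ‖l' - l‖ ^ 2) ≤ t + c * (‖w.x - x‖ ^ 2 +
        (‖w.snd.fst - y₀‖ ^ 2 + (‖w.snd.snd.fst - U‖ ^ 2 +
          (‖w.snd.snd.snd.fst - Θ‖ ^ 2 + ‖w.l - l‖ ^ 2)))) := by
        simp only [mul_add]
        linarith
      exact_mod_cast this
    · rw [hF' w hwl, EReal.top_add_coe]; exact le_top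

/-- The proximal operator of the conjugate of `E`. -/
theorem prox_conjugate_E {C : Set (EuclideanSpace ℝ (Fin d))} {σ : ℝ} (hσ : 0 < σ)
    {x p : EuclideanSpace ℝ (Fin d)} (y₀ : EuclideanSpace ℝ (Fin q)) (U : Mat (Fin q) (Fin k))
    (Θ : PiLp 2 (fun _ : Fin q => SymMat (Fin k))) (l : EuclideanSpace ℝ (Fin m))
    (hp : p ∈ C) (h : ∀ w ∈ C, inner ℝ (σ⁻¹ • x - p) (w - p) ≤ 0) :
    prox σ (conjugate (E q k m C)) (XSpace.mk x y₀ U Θ l) = {XSpace.mk (x - σ • p) 0 0 0 0} := by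
  have hE : E q k m C = indicator {z : XSpace d q k m | z.x ∈ C} := rfl
  -- The set is a cylinder over `C`: the last four blocks are unconstrained and project to
  -- themselves, so Moreau's formula returns zero there.
  rw [hE, prox_conjugate_indicator (p := XSpace.mk p (σ⁻¹ • y₀) (σ⁻¹ • U) (σ⁻¹ • Θ) (σ⁻¹ • l)) hσ
    hp]
  · have e : ∀ {W : Type} [AddCommGroup W] [Module ℝ W] (a : W), a - σ • σ⁻¹ • a = 0 := by
      intro W _ _ a
      rw [smul_smul, mul_inv_cancel₀ hσ.ne', one_smul, sub_self]
    congr 1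
    change XSpace.mk (x - σ • p) (y₀ - σ • σ⁻¹ • y₀) (U - σ • σ⁻¹ • U) (Θ - σ • σ⁻¹ • Θ)
      (l - σ • σ⁻¹ • l) = _
    rw [e, e, e, e]
  · intro w hw
    have e : σ⁻¹ • XSpace.mk x y₀ U Θ l -
        XSpace.mk p (σ⁻¹ • y₀) (σ⁻¹ • U) (σ⁻¹ • Θ) (σ⁻¹ • l) =
        XSpace.mk (σ⁻¹ • x - p) 0 0 0 0 := by
      change XSpace.mk (σ⁻¹ • x - p) (σ⁻¹ • y₀ - σ⁻¹ • y₀) (σ⁻¹ • U - σ⁻¹ • U)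
        (σ⁻¹ • Θ - σ⁻¹ • Θ) (σ⁻¹ • l - σ⁻¹ • l) = _
      simp only [sub_self]
    rw [e]
    simp only [WithLp.prod_inner_apply]
    simp only [XSpace.mk, inner_zero_left, add_zero]
    exact h _ hw

/-- The proximal operator of the conjugate of `G`. -/
theorem prox_conjugate_G {B : Fin m → SymMat (Fin k ⊕ Unit)} {σ : ℝ} (hσ : 0 < σ)
    {Ψ : YSpace k m} {S : Fin m → SymMat (Fin k ⊕ Unit)} (hS : ∀ i, S i ∈ psdCone (Fin k ⊕ Unit))
    (h : ∀ i, ∀ w ∈ psdCone (Fin k ⊕ Unit), inner ℝ (σ⁻¹ • Ψ i - B i - S i) (w - S i) ≤ 0) :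
    prox σ (conjugate (G B)) Ψ = {WithLp.toLp 2 fun i => Ψ i - σ • B i - σ • S i} := by
  have hG : G B = indicator
      {Φ : YSpace k m | ∀ i, Φ i ∈ (fun A => B i + A) '' psdCone (Fin k ⊕ Unit)} := by
    funext Φ
    exact sum_indicator (fun i => (fun A => B i + A) '' psdCone (Fin k ⊕ Unit)) fun i => Φ i
  -- Projection onto the translate `B i + 𝕊₊` is projection onto the cone after shifting by `B i`.
  rw [hG, prox_conjugate_indicator (p := WithLp.toLp 2 fun i => B i + S i) hσ
    (fun i => ⟨S i, hS i, rfl⟩)]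
  · congr 1
    ext1 i
    change Ψ i - σ • (B i + S i) = Ψ i - σ • B i - σ • S i
    rw [smul_add, sub_sub]
  · intro w hw
    rw [PiLp.inner_apply]
    refine Finset.sum_nonpos fun i _ => ?_
    obtain ⟨A, hA, hAw⟩ := hw i
    have h1 := h i A hA
    have e1 : (σ⁻¹ • Ψ - WithLp.toLp 2 fun i => B i + S i : YSpace k m) i =
        σ⁻¹ • Ψ i - B i - S i := by
      change σ⁻¹ • Ψ i - (B i + S i) = _
      rw [sub_sub]
    have e2 : (w - WithLp.toLp 2 fun i => B i + S i : YSpace k m) i = A - S i := by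
      change w i - (B i + S i) = _
      rw [← hAw]
      exact add_sub_add_left_eq_sub _ _ _
    rw [e1, e2]
    exact h1

end Products

end TwoStageARO

open TwoStageARO in
theorem mainTheorem6 (d q k m s : ℕ)
    -- the objective
    (f : EuclideanSpace ℝ (Fin d) → EReal) (hf_proper : IsProper f) (hf_convex : IsConvexFun f)
    (hf_lsc : LowerSemicontinuous f)
    -- the constraint set `C`
    (C : Set (EuclideanSpace ℝ (Fin d))) (hC_nonempty : C.Nonempty) (hC_closed : IsClosed C)
    (hC_convex : Convex ℝ C)
    -- the constraint set `D`, given by SOS-convex polynomials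
    (g : Fin s → MvPolynomial (Fin d) ℝ) (hg : ∀ j, IsSOSConvex (g j))
    (hD_nonempty : (feasibleSet g).Nonempty)
    -- the right-hand sides, which determine the matrices `B_i`
    (b₀ : Fin m → ℝ) (b : Fin m → Fin k → ℝ)
    -- the step sizes and the points
    (τ σ : ℝ) (hτ : 0 < τ) (hσ : 0 < σ)
    (x : EuclideanSpace ℝ (Fin d)) (y₀ : EuclideanSpace ℝ (Fin q)) (U : Mat (Fin q) (Fin k))
    (Θ : PiLp 2 (fun _ : Fin q => SymMat (Fin k))) (l : EuclideanSpace ℝ (Fin m))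
    (Ψ : YSpace k m) :
    -- (i)
    (∃ p : EuclideanSpace ℝ (Fin d), ∃ l' : EuclideanSpace ℝ (Fin m),
      prox τ f x = {p} ∧ proj (orthant m) l = {l'} ∧ (∀ i, l' i = max (l i) 0) ∧
      prox τ (F q k m f) (XSpace.mk x y₀ U Θ l) = {XSpace.mk p y₀ U Θ l'}) ∧
    -- (ii)
    (∃ p : EuclideanSpace ℝ (Fin d),
      proj C (σ⁻¹ • x) = {p} ∧
      prox σ (conjugate (E q k m C)) (XSpace.mk x y₀ U Θ l) =
        {XSpace.mk (x - σ • p) 0 0 0 0}) ∧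
    -- (iii)
    (∃ S : Fin m → SymMat (Fin k ⊕ Unit),
      (∀ i, proj (psdCone (Fin k ⊕ Unit)) (σ⁻¹ • Ψ i - bMatrix (b₀ i) (b i)) = {S i}) ∧
      prox σ (conjugate (G fun i => bMatrix (b₀ i) (b i))) Ψ =
        {WithLp.toLp 2 fun i => Ψ i - σ • bMatrix (b₀ i) (b i) - σ • S i}) ∧
    -- (iv)
    (∃ p : EuclideanSpace ℝ (Fin d),
      proj (feasibleSet g) (σ⁻¹ • x) = {p} ∧
      prox σ (conjugate (H q k m g)) (XSpace.mk x y₀ U Θ l) =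
        {XSpace.mk (x - σ • p) 0 0 0 0}) ∧
    (∀ v : EuclideanSpace ℝ (Fin d),
      (∃ y : MultiIndex d (truncOrder g) → ℝ, IsMomentSolution g v y) ∧
      ∀ y : MultiIndex d (truncOrder g) → ℝ, IsMomentSolution g v y →
        proj (feasibleSet g) v = {firstMoments (truncOrder_spec g).2.1 y}) := by
  refine ⟨?_, ?_, ?_, ?_, exists_isMomentSolution_and_proj_eq_firstMoments hg hD_nonempty⟩
  · obtain ⟨p, hp⟩ := exists_prox_eq_singleton hf_proper hf_convex hf_lsc hτ x
    have hl := proj_orthant l (WithLp.toLp 2 fun i => max (l i) 0) fun _ => rfl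
    exact ⟨p, _, hp, hl, fun _ => rfl, prox_F hf_proper hτ y₀ U Θ hp hl⟩
  · obtain ⟨p, hproj, hp, hvar⟩ :=
      exists_proj_eq_singleton hC_nonempty hC_closed hC_convex (σ⁻¹ • x)
    exact ⟨p, hproj, prox_conjugate_E hσ y₀ U Θ l hp hvar⟩
  · choose S hproj hS hvar using fun i => exists_proj_eq_singleton
      (psdCone_nonempty (Fin k ⊕ Unit)) (isClosed_psdCone _) (convex_psdCone _)
      (σ⁻¹ • Ψ i - bMatrix (b₀ i) (b i))
    exact ⟨S, hproj, prox_conjugate_G hσ hS hvar⟩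
  · obtain ⟨p, hproj, hp, hvar⟩ := exists_proj_eq_singleton hD_nonempty (isClosed_feasibleSet g)
      (convex_feasibleSet hg) (σ⁻¹ • x)
    -- `H` is by definition `E` with `C` replaced by the feasible set.
    exact ⟨p, hproj, prox_conjugate_E hσ y₀ U Θ l hp hvar⟩
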